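/- Let $K$ be a field, $R=K[x_1,x_2,x_3,x_4]$, $\mathfrak m=(x_1,x_2,x_3,x_4)$, let $a_1,\dots,a_6$ be non-negative integers, not all zero, and let $C=C(a_1,\dots,a_6)$ be the tetrahedral curve in $\mathbb P^3$ defined by $$I=(x_1,x_2)^{a_1}\cap(x_1,x_3)^{a_2}\cap(x_1,x_4)^{a_3}\cap(x_2,x_3)^{a_4}\cap(x_2,x_4)^{a_5}\cap(x_3,x_4)^{a_6}.$$ Put $$\mathcal A=\max\{a_2+a_5,\ a_3+a_4,\ a_2+a_4-a_6+1,\ a_3+a_5-a_6+1,\ a_2+a_3-a_1+1,\ a_4+a_5-a_1+1\}.$$ Let $H=H^1_{\mathfrak m}(R/I)$ be the first local cohomology module with its natural $\mathbb Z$-grading, let $\operatorname{diam}(H)=\max\{n: H_n\ne0\}-\min\{n: H_n\neq 0\}+1$ if $H\neq 0$ and $\operatorname{diam}(H)=0$ if $H=0$, and let $k(R/I)$ be the least integer $k\ge0$ with $\mathfrak m^kH=0$. Assume that $a_1+a_6\ge\max\{a_2+a_5,\,a_3+a_4\}$ and that $C$ is not arithmetically Cohen–Macaulay, i.e. the graded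 ring $R/I$ is not Cohen–Macaulay (its depth with respect to $\mathfrak m$ is not equal to its Krull dimension). Then: 1. $a_1+a_6-2\ge\mathcal A$; 2. $H_n\neq0$ for only finitely many $n$, and $k(R/I)=\operatorname{diam}(H)=a_1+a_6-\mathcal A-1$; 3. $H$ has no gap: $H\ne0$, and if $H_i\ne0$ and $H_j\neq0$ with $i\le j$, then $H_l\neq0$ for all $i\le l\le j$. -/

import Mathlib

open MvPolynomial

noncomputable section

namespace TetrahedralCurve

/-- The ideal `(x_i, x_j)` of `K[x₁,x₂,x₃,x₄]`; the variable `x_i` of the usual notation is `X (i - 1)`. -/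
def lineIdeal (K : Type*) [Field K] (i j : Fin 4) : Ideal (MvPolynomial (Fin 4) K) :=
  Ideal.span {X i, X j}

/-- The ideal of the tetrahedral curve `C(a₁,…,a₆)`. -/
def curveIdeal (K : Type*) [Field K] (a₁ a₂ a₃ a₄ a₅ a₆ : ℕ) :
    Ideal (MvPolynomial (Fin 4) K) :=
  lineIdeal K 0 1 ^ a₁ ⊓ lineIdeal K 0 2 ^ a₂ ⊓ lineIdeal K 0 3 ^ a₃ ⊓
    lineIdeal K 1 2 ^ a₄ ⊓ lineIdeal K 1 3 ^ a₅ ⊓ lineIdeal K 2 3 ^ a₆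

/-- For a homogeneous ideal `I`, the graded ring `R/I` is Cohen–Macaulay: its depth (the maximal
length of an `R/I`-regular sequence in the maximal homogeneous ideal `𝔪 = (x₁,x₂,x₃,x₄)`) equals its
Krull dimension. As regular sequences are never longer than the dimension, this says that one of length
`dim R/I` exists. -/
def IsArithmeticallyCohenMacaulay {K : Type*} [Field K]
    (I : Ideal (MvPolynomial (Fin 4) K)) : Prop :=
  ∃ rs : List (MvPolynomial (Fin 4) K),
    (∀ r ∈ rs, r ∈ idealOfVars (Fin 4) K) ∧
    RingTheory.Sequence.IsRegular (MvPolynomial (Fin 4) K ⧸ I) rs ∧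
    ringKrullDim (MvPolynomial (Fin 4) K ⧸ I) = (rs.length : WithBot ℕ∞)

section Cech

variable {K : Type*} [Field K] (I : Ideal (MvPolynomial (Fin 4) K))

/-- The image of the variable `x_i` in `R/I`. -/
def coord (i : Fin 4) : MvPolynomial (Fin 4) K ⧸ I := Ideal.Quotient.mk I (X i)

/-- The localization `(R/I)_{x_i}`. -/
abbrev Loc₁ (i : Fin 4) : Type _ := Localization.Away (coord I i)

/-- The localization `(R/I)_{x_i x_j}`. -/
abbrev Loc₂ (i j : Fin 4) : Type _ := Localization.Away (coord I i * coord I j)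

/-- The degree one term `⨁_i (R/I)_{x_i}` of the Čech complex of `R/I`. -/
abbrev CechC₁ : Type _ := ∀ i : Fin 4, Loc₁ I i

/-- The degree two term `⨁_{i<j} (R/I)_{x_i x_j}` of the Čech complex of `R/I`. -/
abbrev CechC₂ : Type _ := ∀ p : {p : Fin 4 × Fin 4 // p.1 < p.2}, Loc₂ I p.1.1 p.1.2

/-- The localization map `(R/I)_{x_i} → (R/I)_{x_i x_j}`. -/
def locLeft (i j : Fin 4) : Loc₁ I i →ₗ[MvPolynomial (Fin 4) K] Loc₂ I i j where
  toFun := IsLocalization.Away.awayToAwayRight (S := Loc₁ I i) (P := Loc₂ I i j)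
    (coord I i) (coord I j)
  map_add' := map_add _
  map_smul' r z := by
    simp [Algebra.smul_def, IsScalarTower.algebraMap_apply (MvPolynomial (Fin 4) K)
      (MvPolynomial (Fin 4) K ⧸ I) (Loc₁ I i), IsScalarTower.algebraMap_apply
      (MvPolynomial (Fin 4) K) (MvPolynomial (Fin 4) K ⧸ I) (Loc₂ I i j),
      IsLocalization.Away.awayToAwayRight_eq]

/-- The localization map `(R/I)_{x_j} → (R/I)_{x_i x_j}`. -/
def locRight (i j : Fin 4) : Loc₁ I j →ₗ[MvPolynomial (Fin 4) K] Loc₂ I i j where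
  toFun := IsLocalization.Away.awayToAwayLeft (S := Loc₁ I j) (P := Loc₂ I i j)
    (coord I j) (coord I i)
  map_add' := map_add _
  map_smul' r z := by
    simp [Algebra.smul_def, IsScalarTower.algebraMap_apply (MvPolynomial (Fin 4) K)
      (MvPolynomial (Fin 4) K ⧸ I) (Loc₁ I j), IsScalarTower.algebraMap_apply
      (MvPolynomial (Fin 4) K) (MvPolynomial (Fin 4) K ⧸ I) (Loc₂ I i j),
      IsLocalization.Away.awayToAwayLeft_eq]

/-- The Čech differential `R/I → ⨁_i (R/I)_{x_i}`. -/
def cechD₀ : (MvPolynomial (Fin 4) K ⧸ I) →ₗ[MvPolynomial (Fin 4) K] CechC₁ I :=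
  LinearMap.pi fun i =>
    (Algebra.linearMap (MvPolynomial (Fin 4) K ⧸ I) (Loc₁ I i)).restrictScalars
      (MvPolynomial (Fin 4) K)

/-- The Čech differential `⨁_i (R/I)_{x_i} → ⨁_{i<j} (R/I)_{x_i x_j}`, `(z_i) ↦ (z_j - z_i)`. -/
def cechD₁ : CechC₁ I →ₗ[MvPolynomial (Fin 4) K] CechC₂ I :=
  LinearMap.pi fun p =>
    locRight I p.1.1 p.1.2 ∘ₗ LinearMap.proj p.1.2 -
      locLeft I p.1.1 p.1.2 ∘ₗ LinearMap.proj p.1.1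

/-- The local cohomology module `H¹_𝔪(R/I)`, as the first cohomology of the Čech complex. -/
abbrev LocalCohomology₁ : Type _ :=
  LinearMap.ker (cechD₁ I) ⧸ (LinearMap.range (cechD₀ I)).submoduleOf (LinearMap.ker (cechD₁ I))

/-- The elements of degree `n` of `(R/I)_{x_i}` (for homogeneous `I`): the fractions `f / x_i ^ k`
with `f` a form of degree `n + k`. -/
def IsHomogeneousFraction (i : Fin 4) (n : ℤ) (z : Loc₁ I i) : Prop :=
  ∃ (k d : ℕ) (f : MvPolynomial (Fin 4) K), f.IsHomogeneous d ∧ (d : ℤ) = n + k ∧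
    (X i ^ k : MvPolynomial (Fin 4) K) • z =
      algebraMap (MvPolynomial (Fin 4) K ⧸ I) (Loc₁ I i) (Ideal.Quotient.mk I f)

/-- The cochains of degree `n` in `⨁_i (R/I)_{x_i}`. -/
def cechC₁Deg (n : ℤ) : Submodule K (CechC₁ I) where
  carrier := {z | ∀ i, IsHomogeneousFraction I i n (z i)}
  zero_mem' i := by
    refine ⟨n.natAbs, (n + n.natAbs).toNat, 0, isHomogeneous_zero _ _ _, by omega, by simp⟩
  add_mem' {z w} hz hw i := by
    obtain ⟨k, d, f, hf, hd, hz⟩ := hz i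
    obtain ⟨l, e, g, hg, he, hw⟩ := hw i
    refine ⟨k + l, d + l, f * X i ^ l + g * X i ^ k, ?_, by push_cast; omega, ?_⟩
    · have h2 := hg.mul (isHomogeneous_X_pow (R := K) i k)
      rw [show e + k = d + l by omega] at h2
      exact (hf.mul (isHomogeneous_X_pow i l)).add h2
    · have key : ∀ (u : MvPolynomial (Fin 4) K) (q : MvPolynomial (Fin 4) K),
          algebraMap (MvPolynomial (Fin 4) K ⧸ I) (Loc₁ I i) (Ideal.Quotient.mk I (q * u)) =
          u • algebraMap (MvPolynomial (Fin 4) K ⧸ I) (Loc₁ I i) (Ideal.Quotient.mk I q) := by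
        intro u q
        rw [mul_comm, map_mul, map_mul, Algebra.smul_def, IsScalarTower.algebraMap_apply
          (MvPolynomial (Fin 4) K) (MvPolynomial (Fin 4) K ⧸ I) (Loc₁ I i)]
        rfl
      rw [map_add, map_add, key, key, ← hz, ← hw, smul_smul, smul_smul, Pi.add_apply, smul_add,
        ← pow_add, ← pow_add, add_comm l k]
  smul_mem' c z hz i := by
    obtain ⟨k, d, f, hf, hd, hz⟩ := hz i
    refine ⟨k, d, C c * f, ?_, hd, ?_⟩
    · simpa using (isHomogeneous_C (Fin 4) c).mul hf
    · rw [Pi.smul_apply, smul_comm, hz, map_mul, map_mul, Algebra.smul_def]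
      rfl

/-- The graded piece `H¹_𝔪(R/I)_n`: the classes of the cocycles of degree `n`. -/
def localCohomology₁Deg (n : ℤ) : Submodule K (LocalCohomology₁ I) :=
  ((cechC₁Deg I n).comap ((LinearMap.ker (cechD₁ I)).subtype.restrictScalars K)).map
    (((LinearMap.range (cechD₀ I)).submoduleOf (LinearMap.ker (cechD₁ I))).mkQ.restrictScalars K)

end Cech

section Graded

variable {K M : Type*} [Field K] [AddCommGroup M] [Module K M] (𝓜 : ℤ → Submodule K M)

/-- The degrees `n` with `M_n ≠ 0`. -/
def degreeSupport : Set ℤ := {n | 𝓜 n ≠ ⊥}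

open Classical in
/-- The diameter `max {n | M_n ≠ 0} - min {n | M_n ≠ 0} + 1` of a graded module with finitely many
nonzero graded pieces, and `0` if `M = 0`. -/
def diam : ℤ :=
  if degreeSupport 𝓜 = ∅ then 0 else sSup (degreeSupport 𝓜) - sInf (degreeSupport 𝓜) + 1

/-- A nonzero graded module has no gap. -/
def HasNoGap : Prop :=
  (degreeSupport 𝓜).Nonempty ∧
    ∀ i j : ℤ, i ≤ j → 𝓜 i ≠ ⊥ → 𝓜 j ≠ ⊥ → ∀ k : ℤ, i ≤ k → k ≤ j → 𝓜 k ≠ ⊥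

end Graded

/-- The number `𝒜`, the maximum of six integers. -/
def maxA (a₁ a₂ a₃ a₄ a₅ a₆ : ℤ) : ℤ :=
  max (a₂ + a₅) (max (a₃ + a₄) (max (a₂ + a₄ - a₆ + 1) (max (a₃ + a₅ - a₆ + 1)
    (max (a₂ + a₃ - a₁ + 1) (a₄ + a₅ - a₁ + 1)))))

end TetrahedralCurve

end

/-!
The module `H = H¹_𝔪(R/I)` is `ℤ⁴`-graded, and for monomial `I` each multigraded piece of the Čech
complex computes the reduced cohomology of a degree complex. For a tetrahedral curve this complex,
in multidegree `α ∈ ℕ⁴`, is the graph on the vertices `1, …, 4` having an edge `kl` for each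
complementary pair `ij` with `α_i + α_j` smaller than the exponent of `(x_i, x_j)`; multidegrees
outside `ℕ⁴` do not contribute. Hence `H_α ≠ 0` exactly when the graph consists of two opposite
edges. The inequality `a₁ + a₆ ≥ max (a₂ + a₅) (a₃ + a₄)` leaves only the pair `12`, `34`, so that
`H` lives on the set `S` of lattice points (`disconnectedExponents`) with `α₁ + α₂ < a₁`,
`α₃ + α₄ < a₆` and `α_i + α_j` at least the given exponent for the four mixed pairs. A basis is
given by the cocycles `(x^α, x^α, 0, 0)`, `α ∈ S`. The theorem
`exists_pairCochain_add_cechD₀` proves that they span, `pairCochain_monomial_notMem_range` that they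
are not coboundaries. Multiplication by `x^γ` takes the class of `x^α` to that of `x^(α + γ)`.

The rest is a count of lattice points. A point of `S` can be moved up until `α₁ + α₂ = a₁ - 1` and
`α₃ + α₄ = a₆ - 1`, staying in `S`; and a point of degree greater than `𝒜` can be moved to a point
of degree one less (`exists_degree_pred`). So the degrees occurring are those from `𝒜` to
`a₁ + a₆ - 2`, and a chain in `S` from the least to the greatest degree shows that no smaller power
of `𝔪` than the diameter kills `H`.

If `S` is empty, then `H = 0`. As `I` is saturated, `𝔪` contains an `R/I`-regular element `f`, and
`H = 0` forces `I + (f)` to be saturated as well (`mem_sup_span_of_forall_X_mul_mem`), so that there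
is a second regular element. Since `dim R/I = 2`, the ring `R/I` is then Cohen–Macaulay.
-/

noncomputable section

namespace TetrahedralCurve

/-! ### The monomials of the ideal of a tetrahedral curve -/

theorem mem_lineIdeal_pow_iff {K : Type*} [Field K] {i j : Fin 4} (hij : i ≠ j) (a : ℕ)
    (p : MvPolynomial (Fin 4) K) :
    p ∈ lineIdeal K i j ^ a ↔ ∀ β, coeff β p ≠ 0 → a ≤ β i + β j := by
  constructor
  · induction a generalizing p with
    | zero => simp
    | succ a ih =>
      intro hp
      rw [pow_succ] at hp
      refine Submodule.mul_induction_on hp (fun q hq r hr β hβ => ?_) (fun q r hq hr β hβ => ?_)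
      · obtain ⟨γ, hγ, δ, hδ, rfl⟩ :=
          Finset.mem_add.1 (support_mul q r (mem_support_iff.2 hβ))
        have h1 := ih q hq γ (mem_support_iff.1 hγ)
        have himg : ({X i, X j} : Set (MvPolynomial (Fin 4) K)) = X '' {i, j} := by
          rw [Set.image_pair]
        rw [lineIdeal, himg, mem_ideal_span_X_image] at hr
        obtain ⟨k, hk, hk0⟩ := hr δ hδ
        have h2 : 1 ≤ δ i + δ j := by
          rcases hk with rfl | rfl <;> omega
        simp only [Finsupp.add_apply]
        omega
      · by_cases h : coeff β q = 0
        · exact hr β (by simpa [h] using hβ)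
        · exact hq β h
  · intro h
    rw [p.as_sum]
    refine Ideal.sum_mem _ fun β hβ => ?_
    have hle : Finsupp.single i (β i) + Finsupp.single j (β j) ≤ β := by
      intro k
      simp only [Finsupp.add_apply, Finsupp.single_apply]
      split_ifs with h1 h2 h2
      · exact absurd (h1.trans h2.symm) hij
      · simp [h1]
      · simp [h2]
      · simp
    have hmon : monomial β (coeff β p) = monomial (β - (Finsupp.single i (β i) +
        Finsupp.single j (β j))) (coeff β p) * (X i ^ β i * X j ^ β j) := by
      rw [X_pow_eq_monomial, X_pow_eq_monomial, monomial_mul, monomial_mul,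
        tsub_add_cancel_of_le hle]
      simp
    rw [hmon]
    refine Ideal.mul_mem_left _ _ (Ideal.pow_le_pow_right (h β (mem_support_iff.1 hβ)) ?_)
    rw [pow_add]
    exact Ideal.mul_mem_mul (Ideal.pow_mem_pow (Ideal.subset_span (by simp)) _)
      (Ideal.pow_mem_pow (Ideal.subset_span (by simp)) _)

/-- The exponents `w i j` of the ideals `(x_i, x_j)` in the ideal of the curve; only the entries
with `i < j` are used. -/
def edgeWeight (a₁ a₂ a₃ a₄ a₅ a₆ : ℕ) : Fin 4 → Fin 4 → ℕ :=
  ![![0, a₁, a₂, a₃], ![0, 0, a₄, a₅], ![0, 0, 0, a₆], ![0, 0, 0, 0]]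

/-- The monomial `x^β` lies in `(x_i, x_j)^(w i j)` for all edges `ij` avoiding the support of `t`.
For the curve ideal `I` with weights `w` this says that `x^β` vanishes in the localization of `R/I`
at `x^t`. -/
def SatisfiesWeights (w : Fin 4 → Fin 4 → ℕ) (t β : Fin 4 →₀ ℕ) : Prop :=
  ∀ i j, i < j → t i = 0 → t j = 0 → w i j ≤ β i + β j

/-- `I` is the monomial ideal of all polynomials supported on the `β` with
`w i j ≤ β i + β j` for all `i < j`. -/
def HasWeights {K : Type*} [Field K] (I : Ideal (MvPolynomial (Fin 4) K))
    (w : Fin 4 → Fin 4 → ℕ) : Prop :=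
  ∀ p, p ∈ I ↔ ∀ β, coeff β p ≠ 0 → SatisfiesWeights w 0 β

theorem curveIdeal_hasWeights (K : Type*) [Field K] (a₁ a₂ a₃ a₄ a₅ a₆ : ℕ) :
    HasWeights (curveIdeal K a₁ a₂ a₃ a₄ a₅ a₆) (edgeWeight a₁ a₂ a₃ a₄ a₅ a₆) := by
  intro p
  simp only [curveIdeal, Ideal.mem_inf, mem_lineIdeal_pow_iff (show (0 : Fin 4) ≠ 1 by decide),
    mem_lineIdeal_pow_iff (show (0 : Fin 4) ≠ 2 by decide),
    mem_lineIdeal_pow_iff (show (0 : Fin 4) ≠ 3 by decide),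
    mem_lineIdeal_pow_iff (show (1 : Fin 4) ≠ 2 by decide),
    mem_lineIdeal_pow_iff (show (1 : Fin 4) ≠ 3 by decide),
    mem_lineIdeal_pow_iff (show (2 : Fin 4) ≠ 3 by decide)]
  constructor
  · rintro ⟨⟨⟨⟨⟨h1, h2⟩, h3⟩, h4⟩, h5⟩, h6⟩ β hβ i j hij - -
    have := h1 β hβ
    have := h2 β hβ
    have := h3 β hβ
    have := h4 β hβ
    have := h5 β hβ
    have := h6 β hβ
    fin_cases i <;> fin_cases j <;> first | (exact absurd hij (by decide)) | simpa [edgeWeight]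
  · intro h
    refine ⟨⟨⟨⟨⟨?_, ?_⟩, ?_⟩, ?_⟩, ?_⟩, ?_⟩ <;> intro β hβ
    · exact h β hβ 0 1 (by decide) rfl rfl
    · exact h β hβ 0 2 (by decide) rfl rfl
    · exact h β hβ 0 3 (by decide) rfl rfl
    · exact h β hβ 1 2 (by decide) rfl rfl
    · exact h β hβ 1 3 (by decide) rfl rfl
    · exact h β hβ 2 3 (by decide) rfl rfl

section Vanishing

variable {K : Type*} [Field K] {I : Ideal (MvPolynomial (Fin 4) K)} {w : Fin 4 → Fin 4 → ℕ}

/-- A polynomial vanishes in the localization of `R/I` at `x^t` if and only if each of its monomials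
satisfies the weights of the edges avoiding the support of `t`. -/
theorem exists_monomial_pow_mul_mem_iff (hI : HasWeights I w) (t : Fin 4 →₀ ℕ)
    (p : MvPolynomial (Fin 4) K) :
    (∃ n : ℕ, monomial t (1 : K) ^ n * p ∈ I) ↔
      ∀ β, coeff β p ≠ 0 → SatisfiesWeights w t β := by
  constructor
  · rintro ⟨n, hn⟩ β hβ i j hij hi hj
    have h := (hI _).1 hn (n • t + β) (by
      rw [monomial_pow, coeff_monomial_mul]
      simpa using hβ) i j hij rfl rfl
    simpa [hi, hj] using h
  · intro h
    -- The power `∑ w i j` of `x^t` makes the constraints at edges meeting the support of `t` hold.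
    refine ⟨∑ i, ∑ j, w i j, (hI _).2 fun β hβ i j hij _ _ => ?_⟩
    rw [monomial_pow, coeff_monomial_mul'] at hβ
    split_ifs at hβ with hle
    · have hle' : ∀ k, (∑ i, ∑ j, w i j) * t k ≤ β k := fun k => by simpa using hle k
      by_cases hi : t i = 0
      · by_cases hj : t j = 0
        · have := h (β - (∑ i, ∑ j, w i j) • t) (by simpa using hβ) i j hij hi hj
          simpa [hi, hj] using this
        · have h1 : w i j ≤ ∑ i, ∑ j, w i j :=
            (Finset.single_le_sum (f := w i) (by simp) (Finset.mem_univ j)).trans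
              (Finset.single_le_sum (f := fun i => ∑ j, w i j) (by simp) (Finset.mem_univ i))
          have h2 := Nat.le_mul_of_pos_right (∑ i, ∑ j, w i j) (Nat.pos_of_ne_zero hj)
          have := hle' j
          omega
      · have h1 : w i j ≤ ∑ i, ∑ j, w i j :=
          (Finset.single_le_sum (f := w i) (by simp) (Finset.mem_univ j)).trans
            (Finset.single_le_sum (f := fun i => ∑ j, w i j) (by simp) (Finset.mem_univ i))
        have h2 := Nat.le_mul_of_pos_right (∑ i, ∑ j, w i j) (Nat.pos_of_ne_zero hi)
        have := hle' i
        omega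
    · exact absurd rfl hβ

theorem algebraMap_away_eq_zero_iff (hI : HasWeights I w) (t : Fin 4 →₀ ℕ)
    {x : MvPolynomial (Fin 4) K ⧸ I} (hx : x = Ideal.Quotient.mk I (monomial t 1))
    (p : MvPolynomial (Fin 4) K) :
    algebraMap (MvPolynomial (Fin 4) K ⧸ I) (Localization.Away x) (Ideal.Quotient.mk I p) = 0 ↔
      ∀ β, coeff β p ≠ 0 → SatisfiesWeights w t β := by
  rw [IsLocalization.map_eq_zero_iff (Submonoid.powers x),
    ← exists_monomial_pow_mul_mem_iff hI]
  constructor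
  · rintro ⟨⟨_, n, rfl⟩, h⟩
    refine ⟨n, Ideal.Quotient.eq_zero_iff_mem.1 ?_⟩
    simpa [hx] using h
  · rintro ⟨n, h⟩
    refine ⟨⟨x ^ n, n, rfl⟩, ?_⟩
    simpa [hx] using Ideal.Quotient.eq_zero_iff_mem.2 h

theorem algebraMap_loc₁_eq_zero_iff (hI : HasWeights I w) (i : Fin 4)
    (p : MvPolynomial (Fin 4) K) :
    algebraMap (MvPolynomial (Fin 4) K ⧸ I) (Loc₁ I i) (Ideal.Quotient.mk I p) = 0 ↔
      ∀ β, coeff β p ≠ 0 → SatisfiesWeights w (Finsupp.single i 1) β :=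
  algebraMap_away_eq_zero_iff hI _ rfl p

theorem algebraMap_loc₂_eq_zero_iff (hI : HasWeights I w) (i j : Fin 4)
    (p : MvPolynomial (Fin 4) K) :
    algebraMap (MvPolynomial (Fin 4) K ⧸ I) (Loc₂ I i j) (Ideal.Quotient.mk I p) = 0 ↔
      ∀ β, coeff β p ≠ 0 → SatisfiesWeights w (Finsupp.single i 1 + Finsupp.single j 1) β :=
  algebraMap_away_eq_zero_iff hI _ (by
    rw [coord, coord, ← map_mul, X, X, monomial_mul, one_mul]) p

end Vanishing

/-! ### The lattice points carrying the cohomology -/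

section LatticePoints

variable {a₁ a₂ a₃ a₄ a₅ a₆ : ℕ}

/-- The exponents `α` in which the degree complex of `R/I` consists of the two disjoint edges
`{1,2}` and `{3,4}`: the monomial `x^α` lies in the four mixed line ideals, but neither in
`(x₁,x₂)^a₁` nor in `(x₃,x₄)^a₆`. -/
def disconnectedExponents (a₁ a₂ a₃ a₄ a₅ a₆ : ℕ) : Set (Fin 4 →₀ ℕ) :=
  {α | α 0 + α 1 < a₁ ∧ α 2 + α 3 < a₆ ∧ a₂ ≤ α 0 + α 2 ∧ a₃ ≤ α 0 + α 3 ∧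
    a₄ ≤ α 1 + α 2 ∧ a₅ ≤ α 1 + α 3}

theorem degree_eq_sum_four (α : Fin 4 →₀ ℕ) : α.degree = α 0 + α 1 + α 2 + α 3 := by
  rw [Finsupp.degree_eq_sum, Fin.sum_univ_four]

/-- The exponent vector with the given entries. -/
def exponent (x y z t : ℕ) : Fin 4 →₀ ℕ := Finsupp.equivFunOnFinite.symm ![x, y, z, t]

@[simp] theorem exponent_zero (x y z t : ℕ) : exponent x y z t 0 = x := rfl
@[simp] theorem exponent_one (x y z t : ℕ) : exponent x y z t 1 = y := rfl
@[simp] theorem exponent_two (x y z t : ℕ) : exponent x y z t 2 = z := rfl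
@[simp] theorem exponent_three (x y z t : ℕ) : exponent x y z t 3 = t := rfl

theorem maxA_le_degree {α : Fin 4 →₀ ℕ} (hα : α ∈ disconnectedExponents a₁ a₂ a₃ a₄ a₅ a₆) :
    maxA a₁ a₂ a₃ a₄ a₅ a₆ ≤ α.degree := by
  obtain ⟨h1, h2, h3, h4, h5, h6⟩ := hα
  rw [degree_eq_sum_four]
  simp only [maxA, max_le_iff]
  push_cast
  omega

theorem degree_add_two_le {α : Fin 4 →₀ ℕ}
    (hα : α ∈ disconnectedExponents a₁ a₂ a₃ a₄ a₅ a₆) : α.degree + 2 ≤ a₁ + a₆ := by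
  obtain ⟨h1, h2, -⟩ := hα
  rw [degree_eq_sum_four]
  omega

/-- A point whose degree exceeds `𝒜` can be moved to one of degree one less. The edges `13`, `14`,
`23`, `24` on which the constraint is tight contain no two opposite ones, so they are none, one, or
two sharing a vertex. In the first two cases some unit vector can be subtracted; in the last,
adding the unit vector of the shared vertex and subtracting those of its two neighbours is a second
possibility. -/
theorem exists_degree_pred {α : Fin 4 →₀ ℕ}
    (hα : α ∈ disconnectedExponents a₁ a₂ a₃ a₄ a₅ a₆)
    (hlt : maxA a₁ a₂ a₃ a₄ a₅ a₆ < α.degree) :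
    ∃ β ∈ disconnectedExponents a₁ a₂ a₃ a₄ a₅ a₆, β.degree + 1 = α.degree := by
  have key : ∀ x y z t : ℕ, (x + y < a₁ ∧ z + t < a₆ ∧ a₂ ≤ x + z ∧ a₃ ≤ x + t ∧
      a₄ ≤ y + z ∧ a₅ ≤ y + t) → x + y + z + t + 1 = α 0 + α 1 + α 2 + α 3 →
      ∃ β ∈ disconnectedExponents a₁ a₂ a₃ a₄ a₅ a₆, β.degree + 1 = α.degree := by
    intro x y z t h hd
    refine ⟨exponent x y z t, h, ?_⟩
    rw [degree_eq_sum_four, degree_eq_sum_four]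
    exact hd
  obtain ⟨h1, h2, h3, h4, h5, h6⟩ := hα
  rw [degree_eq_sum_four] at hlt
  simp only [maxA, max_lt_iff] at hlt
  push_cast at hlt
  obtain ⟨k1, k2, k3, k4, k5, k6⟩ := hlt
  generalize α 0 = x at *
  generalize α 1 = y at *
  generalize α 2 = z at *
  generalize α 3 = t at *
  by_cases m1 : 0 < x ∧ a₂ < x + z ∧ a₃ < x + t
  · exact key (x - 1) y z t (by omega) (by omega)
  by_cases m2 : 0 < y ∧ a₄ < y + z ∧ a₅ < y + t
  · exact key x (y - 1) z t (by omega) (by omega)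
  by_cases m3 : 0 < z ∧ a₂ < x + z ∧ a₄ < y + z
  · exact key x y (z - 1) t (by omega) (by omega)
  by_cases m4 : 0 < t ∧ a₃ < x + t ∧ a₅ < y + t
  · exact key x y z (t - 1) (by omega) (by omega)
  by_cases t13 : a₂ = x + z
  · by_cases t14 : a₃ = x + t
    · exact key (x + 1) y (z - 1) (t - 1) (by omega) (by omega)
    · by_cases t23 : a₄ = y + z
      · exact key (x - 1) (y - 1) (z + 1) t (by omega) (by omega)
      · omega
  · by_cases t14 : a₃ = x + t
    · by_cases t24 : a₅ = y + t
      · exact key (x - 1) (y - 1) z (t + 1) (by omega) (by omega)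
      · omega
    · by_cases t23 : a₄ = y + z
      · by_cases t24 : a₅ = y + t
        · exact key x (y + 1) (z - 1) (t - 1) (by omega) (by omega)
        · omega
      · omega

theorem exists_degree_eq_maxA (h : (disconnectedExponents a₁ a₂ a₃ a₄ a₅ a₆).Nonempty) :
    ∃ α ∈ disconnectedExponents a₁ a₂ a₃ a₄ a₅ a₆,
      (α.degree : ℤ) = maxA a₁ a₂ a₃ a₄ a₅ a₆ := by
  obtain ⟨α, hα, hmin⟩ := exists_minimalFor_of_wellFoundedLT
    (fun α => α ∈ disconnectedExponents a₁ a₂ a₃ a₄ a₅ a₆) (fun α => α.degree) h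
  refine ⟨α, hα, le_antisymm (not_lt.1 fun hlt => ?_) (maxA_le_degree hα)⟩
  obtain ⟨β, hβ, hd⟩ := exists_degree_pred hα hlt
  have := hmin hβ (by dsimp only; omega)
  dsimp only at this
  omega

theorem exists_le_degree_eq {α : Fin 4 →₀ ℕ}
    (hα : α ∈ disconnectedExponents a₁ a₂ a₃ a₄ a₅ a₆) {d : ℕ} (h1 : α.degree ≤ d)
    (h2 : d + 2 ≤ a₁ + a₆) :
    ∃ β ∈ disconnectedExponents a₁ a₂ a₃ a₄ a₅ a₆, α ≤ β ∧ β.degree = d := by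
  obtain ⟨g1, g2, g3, g4, g5, g6⟩ := hα
  rw [degree_eq_sum_four] at h1
  -- As much as possible of the excess degree goes into the first entry, the rest into the third.
  obtain ⟨s, u, hs, hu, hd⟩ : ∃ s u : ℕ, α 0 + s + α 1 < a₁ ∧ α 2 + u + α 3 < a₆ ∧
      α 0 + α 1 + α 2 + α 3 + s + u = d := by
    by_cases h : d < α 2 + α 3 + a₁
    · exact ⟨d - (α 0 + α 1 + α 2 + α 3), 0, by omega, by omega, by omega⟩
    · exact ⟨a₁ - 1 - (α 0 + α 1), d + 1 - a₁ - (α 2 + α 3), by omega, by omega, by omega⟩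
  refine ⟨exponent (α 0 + s) (α 1) (α 2 + u) (α 3), ?_, ?_, ?_⟩
  · simp only [disconnectedExponents, Set.mem_ofPred_eq, exponent_zero, exponent_one, exponent_two,
      exponent_three]
    omega
  · intro i
    fin_cases i <;> simp
  · simp only [degree_eq_sum_four, exponent_zero, exponent_one, exponent_two, exponent_three]
    omega

/-- The degrees of the lattice points form the interval `[𝒜, a₁ + a₆ - 2]`. -/
theorem exists_degree_eq_iff (h : (disconnectedExponents a₁ a₂ a₃ a₄ a₅ a₆).Nonempty) (n : ℤ) :
    (∃ α ∈ disconnectedExponents a₁ a₂ a₃ a₄ a₅ a₆, (α.degree : ℤ) = n) ↔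
      n ∈ Set.Icc (maxA a₁ a₂ a₃ a₄ a₅ a₆) (a₁ + a₆ - 2) := by
  constructor
  · rintro ⟨α, hα, rfl⟩
    have := degree_add_two_le hα
    exact ⟨maxA_le_degree hα, by omega⟩
  · rintro ⟨h1, h2⟩
    obtain ⟨α, hα, hd⟩ := exists_degree_eq_maxA h
    obtain ⟨β, hβ, -, hβd⟩ := exists_le_degree_eq hα (d := n.toNat) (by omega) (by omega)
    exact ⟨β, hβ, by omega⟩

end LatticePoints

/-! ### Čech cocycles -/

section Cocycles

variable {K : Type*} [Field K] (I : Ideal (MvPolynomial (Fin 4) K))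

theorem smul_eq_algebraMap_mul {L : Type*} [CommRing L]
    [Algebra (MvPolynomial (Fin 4) K ⧸ I) L] [Algebra (MvPolynomial (Fin 4) K) L]
    [IsScalarTower (MvPolynomial (Fin 4) K) (MvPolynomial (Fin 4) K ⧸ I) L]
    (p : MvPolynomial (Fin 4) K) (z : L) :
    p • z = algebraMap (MvPolynomial (Fin 4) K ⧸ I) L (Ideal.Quotient.mk I p) * z := by
  rw [Algebra.smul_def, IsScalarTower.algebraMap_apply (MvPolynomial (Fin 4) K)
    (MvPolynomial (Fin 4) K ⧸ I) L]
  rfl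

theorem X_pow_smul_eq_zero_iff {i : Fin 4} (k : ℕ) (z : Loc₁ I i) :
    (X i ^ k : MvPolynomial (Fin 4) K) • z = 0 ↔ z = 0 := by
  rw [smul_eq_algebraMap_mul I, map_pow, map_pow]
  exact ((IsLocalization.Away.algebraMap_isUnit (S := Loc₁ I i) (coord I i)).pow k).mul_right_eq_zero

theorem X_mul_X_pow_smul_eq_zero_iff {i j : Fin 4} (k : ℕ) (z : Loc₂ I i j) :
    ((X i * X j) ^ k : MvPolynomial (Fin 4) K) • z = 0 ↔ z = 0 := by
  rw [smul_eq_algebraMap_mul I, map_pow, map_pow]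
  exact ((IsLocalization.Away.algebraMap_isUnit (S := Loc₂ I i j)
    (coord I i * coord I j)).pow k).mul_right_eq_zero

@[simp] theorem locLeft_algebraMap (i j : Fin 4) (x : MvPolynomial (Fin 4) K ⧸ I) :
    locLeft I i j (algebraMap _ _ x) = algebraMap _ _ x :=
  IsLocalization.Away.awayToAwayRight_eq (coord I i) (coord I j) x

@[simp] theorem locRight_algebraMap (i j : Fin 4) (x : MvPolynomial (Fin 4) K ⧸ I) :
    locRight I i j (algebraMap _ _ x) = algebraMap _ _ x :=
  IsLocalization.Away.awayToAwayLeft_eq (coord I j) (coord I i) x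

/-- The tuple `z` of fractions is `(f i / x_i ^ k)`. -/
def IsRepresentedBy (z : CechC₁ I) (k : ℕ) (f : Fin 4 → MvPolynomial (Fin 4) K) : Prop :=
  ∀ i, (X i ^ k : MvPolynomial (Fin 4) K) • z i =
    algebraMap (MvPolynomial (Fin 4) K ⧸ I) (Loc₁ I i) (Ideal.Quotient.mk I (f i))

variable {I}

/-- Fractions can be brought to a common exponent in the denominators. -/
theorem IsRepresentedBy.of_exponents {z : CechC₁ I} {k : Fin 4 → ℕ}
    {f : Fin 4 → MvPolynomial (Fin 4) K}
    (h : ∀ i, (X i ^ k i : MvPolynomial (Fin 4) K) • z i =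
      algebraMap (MvPolynomial (Fin 4) K ⧸ I) (Loc₁ I i) (Ideal.Quotient.mk I (f i))) :
    IsRepresentedBy I z (∑ i, k i) fun i => X i ^ ((∑ i, k i) - k i) * f i := by
  intro i
  have hle : k i ≤ ∑ i, k i := Finset.single_le_sum (by simp) (Finset.mem_univ i)
  rw [map_mul, map_mul, ← h, ← smul_eq_algebraMap_mul, smul_smul, ← pow_add,
    Nat.sub_add_cancel hle]

theorem exists_isRepresentedBy (z : CechC₁ I) : ∃ k f, IsRepresentedBy I z k f := by
  have h : ∀ i, ∃ (k : ℕ) (f : MvPolynomial (Fin 4) K), (X i ^ k : MvPolynomial (Fin 4) K) • z i =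
      algebraMap (MvPolynomial (Fin 4) K ⧸ I) (Loc₁ I i) (Ideal.Quotient.mk I f) := by
    intro i
    obtain ⟨⟨a, ⟨_, k, rfl⟩⟩, h⟩ := IsLocalization.surj (Submonoid.powers (coord I i)) (z i)
    obtain ⟨f, rfl⟩ := Ideal.Quotient.mk_surjective a
    refine ⟨k, f, ?_⟩
    rw [← h, smul_eq_algebraMap_mul I, map_pow, mul_comm]
    rfl
  choose k f hf using h
  exact ⟨_, _, IsRepresentedBy.of_exponents hf⟩

theorem exists_isRepresentedBy_of_mem_deg {z : CechC₁ I} {n : ℤ} (hz : z ∈ cechC₁Deg I n) :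
    ∃ k f, IsRepresentedBy I z k f ∧ ∀ i β, coeff β (f i) ≠ 0 → (β.degree : ℤ) = n + k := by
  choose k d f hf hd h using hz
  refine ⟨_, _, IsRepresentedBy.of_exponents h, fun i β hβ => ?_⟩
  have hle : k i ≤ ∑ i, k i := Finset.single_le_sum (by simp) (Finset.mem_univ i)
  have h1 := ((isHomogeneous_X_pow (R := K) i ((∑ i, k i) - k i)).mul (hf i)).coeff_eq_zero
    (d := β)
  have h2 : β.degree = (∑ i, k i) - k i + d i := by
    by_contra hne
    exact hβ (h1 hne)
  have := hd i
  omega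

theorem mem_ker_cechD₁_iff (z : CechC₁ I) :
    z ∈ LinearMap.ker (cechD₁ I) ↔ ∀ i j, i < j → locRight I i j (z j) = locLeft I i j (z i) := by
  rw [LinearMap.mem_ker, funext_iff]
  simp only [cechD₁, LinearMap.pi_apply, LinearMap.sub_apply, LinearMap.comp_apply,
    LinearMap.proj_apply, Pi.zero_apply, sub_eq_zero, Subtype.forall, Prod.forall]

variable {w : Fin 4 → Fin 4 → ℕ}

/-- The cocycle condition in terms of numerators: the cross differences `x_i^k f_j - x_j^k f_i`
vanish in the localization at `x_i x_j`. -/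
theorem IsRepresentedBy.mem_ker_iff (hI : HasWeights I w) {z : CechC₁ I} {k : ℕ}
    {f : Fin 4 → MvPolynomial (Fin 4) K} (h : IsRepresentedBy I z k f) :
    z ∈ LinearMap.ker (cechD₁ I) ↔ ∀ i j, i < j → ∀ β,
      coeff β (X i ^ k * f j - X j ^ k * f i) ≠ 0 →
        SatisfiesWeights w (Finsupp.single i 1 + Finsupp.single j 1) β := by
  rw [mem_ker_cechD₁_iff]
  refine forall_congr' fun i => forall_congr' fun j => imp_congr_right fun _ => ?_
  rw [← algebraMap_loc₂_eq_zero_iff hI, ← sub_eq_zero, ← X_mul_X_pow_smul_eq_zero_iff I k]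
  have key : ((X i * X j) ^ k : MvPolynomial (Fin 4) K) •
      (locRight I i j (z j) - locLeft I i j (z i)) =
      algebraMap (MvPolynomial (Fin 4) K ⧸ I) (Loc₂ I i j)
        (Ideal.Quotient.mk I (X i ^ k * f j - X j ^ k * f i)) := by
    rw [map_sub, map_sub, map_mul, map_mul, map_mul, map_mul, ← smul_eq_algebraMap_mul I,
      ← smul_eq_algebraMap_mul I, ← locRight_algebraMap I i j, ← locLeft_algebraMap I i j,
      ← h i, ← h j, map_smul, map_smul, smul_smul, smul_smul, ← mul_pow, ← mul_pow,
      mul_comm (X j), smul_sub]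
  rw [key]

variable (I) in
/-- The cochain `(g, g, 0, 0)`. -/
def pairCochain : MvPolynomial (Fin 4) K →ₗ[MvPolynomial (Fin 4) K] CechC₁ I :=
  LinearMap.pi fun i => if i = 0 ∨ i = 1 then
    LinearMap.proj i ∘ₗ cechD₀ I ∘ₗ (Ideal.Quotient.mkₐ (MvPolynomial (Fin 4) K) I).toLinearMap
    else 0

theorem pairCochain_apply (g : MvPolynomial (Fin 4) K) (i : Fin 4) :
    pairCochain I g i = algebraMap (MvPolynomial (Fin 4) K ⧸ I) (Loc₁ I i)
      (Ideal.Quotient.mk I (if i = 0 ∨ i = 1 then g else 0)) := by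
  simp only [pairCochain, LinearMap.pi_apply]
  split_ifs
  · rfl
  · simp

theorem cechD₀_mk_apply (h : MvPolynomial (Fin 4) K) (i : Fin 4) :
    cechD₀ I (Ideal.Quotient.mk I h) i =
      algebraMap (MvPolynomial (Fin 4) K ⧸ I) (Loc₁ I i) (Ideal.Quotient.mk I h) := rfl

theorem pairCochain_isRepresentedBy (g : MvPolynomial (Fin 4) K) :
    IsRepresentedBy I (pairCochain I g) 0 fun i => if i = 0 ∨ i = 1 then g else 0 := by
  intro i
  rw [pow_zero, one_smul, pairCochain_apply]

/-- A polynomial with prescribed coefficients on a finite set of exponents. -/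
theorem exists_coeff_eq (F : (Fin 4 →₀ ℕ) → K) (T : Finset (Fin 4 →₀ ℕ))
    (h : ∀ β, F β ≠ 0 → β ∈ T) : ∃ p : MvPolynomial (Fin 4) K, ∀ β, coeff β p = F β := by
  classical
  refine ⟨∑ β ∈ T, monomial β (F β), fun β => ?_⟩
  rw [coeff_sum]
  simp only [coeff_monomial, Finset.sum_ite_eq']
  split_ifs with hβ
  · rfl
  · by_contra hne
    exact hβ (h β (Ne.symm hne))

end Cocycles

section Curve

variable {K : Type*} [Field K] {a₁ a₂ a₃ a₄ a₅ a₆ : ℕ}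
  {I : Ideal (MvPolynomial (Fin 4) K)}

theorem satisfiesWeights_single_iff (i : Fin 4) (β : Fin 4 →₀ ℕ) :
    SatisfiesWeights (edgeWeight a₁ a₂ a₃ a₄ a₅ a₆) (Finsupp.single i 1) β ↔
      ((i ≠ 0 → i ≠ 1 → a₁ ≤ β 0 + β 1) ∧ (i ≠ 0 → i ≠ 2 → a₂ ≤ β 0 + β 2) ∧
      (i ≠ 0 → i ≠ 3 → a₃ ≤ β 0 + β 3) ∧ (i ≠ 1 → i ≠ 2 → a₄ ≤ β 1 + β 2) ∧
      (i ≠ 1 → i ≠ 3 → a₅ ≤ β 1 + β 3) ∧ (i ≠ 2 → i ≠ 3 → a₆ ≤ β 2 + β 3)) := by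
  fin_cases i <;>
    simp [SatisfiesWeights, edgeWeight, Fin.forall_fin_succ, Finsupp.single_apply, and_assoc]

theorem satisfiesWeights_pair_iff (i j : Fin 4) (β : Fin 4 →₀ ℕ) :
    SatisfiesWeights (edgeWeight a₁ a₂ a₃ a₄ a₅ a₆)
      (Finsupp.single i 1 + Finsupp.single j 1) β ↔
      ((i ≠ 0 → i ≠ 1 → j ≠ 0 → j ≠ 1 → a₁ ≤ β 0 + β 1) ∧
      (i ≠ 0 → i ≠ 2 → j ≠ 0 → j ≠ 2 → a₂ ≤ β 0 + β 2) ∧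
      (i ≠ 0 → i ≠ 3 → j ≠ 0 → j ≠ 3 → a₃ ≤ β 0 + β 3) ∧
      (i ≠ 1 → i ≠ 2 → j ≠ 1 → j ≠ 2 → a₄ ≤ β 1 + β 2) ∧
      (i ≠ 1 → i ≠ 3 → j ≠ 1 → j ≠ 3 → a₅ ≤ β 1 + β 3) ∧
      (i ≠ 2 → i ≠ 3 → j ≠ 2 → j ≠ 3 → a₆ ≤ β 2 + β 3)) := by
  fin_cases i <;> fin_cases j <;>
    simp [SatisfiesWeights, edgeWeight, Fin.forall_fin_succ, Finsupp.single_apply, and_assoc]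

theorem pairCochain_mem_ker (hI : HasWeights I (edgeWeight a₁ a₂ a₃ a₄ a₅ a₆))
    {g : MvPolynomial (Fin 4) K}
    (hg : ∀ β, coeff β g ≠ 0 → a₂ ≤ β 0 + β 2 ∧ a₃ ≤ β 0 + β 3 ∧ a₄ ≤ β 1 + β 2 ∧
      a₅ ≤ β 1 + β 3) :
    pairCochain I g ∈ LinearMap.ker (cechD₁ I) := by
  rw [(pairCochain_isRepresentedBy g).mem_ker_iff hI]
  intro i j hij β hβ
  rw [satisfiesWeights_pair_iff]
  rw [pow_zero, one_mul, pow_zero, one_mul] at hβ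
  fin_cases i <;> fin_cases j <;> first | exact absurd hij (by decide) | skip
  all_goals simp at hβ ⊢
  all_goals first | exact (hg β hβ).1 | exact (hg β hβ).2.1 | exact (hg β hβ).2.2.1 |
    exact (hg β hβ).2.2.2

theorem pairCochain_monomial_notMem_range
    (hI : HasWeights I (edgeWeight a₁ a₂ a₃ a₄ a₅ a₆)) {β : Fin 4 →₀ ℕ}
    (hβ : β ∈ disconnectedExponents a₁ a₂ a₃ a₄ a₅ a₆) :
    pairCochain I (monomial β 1) ∉ LinearMap.range (cechD₀ I) := by
  rintro ⟨h', hh⟩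
  obtain ⟨h, rfl⟩ := Ideal.Quotient.mk_surjective h'
  obtain ⟨g1, g2, -⟩ := hβ
  have h0 := congrFun hh 0
  have h2 := congrFun hh 2
  rw [pairCochain_apply, cechD₀_mk_apply, ← sub_eq_zero, ← map_sub, ← map_sub,
    algebraMap_loc₁_eq_zero_iff hI] at h0 h2
  have c0 : coeff β (h - monomial β 1) = 0 := by
    by_contra hne
    have := ((satisfiesWeights_single_iff _ _).1 (h0 β (by simpa using hne))).2.2.2.2.2
      (by decide) (by decide)
    omega
  have c2 : coeff β h = 0 := by
    by_contra hne
    have := ((satisfiesWeights_single_iff _ _).1 (h2 β (by simpa using hne))).1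
      (by decide) (by decide)
    omega
  simp [c2] at c0

/-- Gluing in a fixed multidegree: `c i` is the coefficient of a cocycle on the vertex `i`, and
`pᵢⱼ` says that the edge complementary to `ij` is absent from the degree complex. If the degree
complex is disconnected, then its edges are `{0,1}` and `{2,3}`; in every other case the
coefficients agree on all of its vertices. -/
theorem glue_coefficients {p₀₁ p₀₂ p₀₃ p₁₂ p₁₃ p₂₃ : Prop} [Decidable p₀₁]
    [Decidable p₀₂] [Decidable p₀₃] [Decidable p₁₂] [Decidable p₁₃] [Decidable p₂₃] (c : Fin 4 → K)
    (h01 : c 0 ≠ c 1 → p₂₃) (h02 : c 0 ≠ c 2 → p₁₃) (h03 : c 0 ≠ c 3 → p₁₂)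
    (h12 : c 1 ≠ c 2 → p₀₃) (h13 : c 1 ≠ c 3 → p₀₂) (h23 : c 2 ≠ c 3 → p₀₁)
    (hA : ¬ (p₀₁ ∧ p₂₃ ∧ ¬ p₀₂ ∧ ¬ p₁₃ ∧ p₀₃ ∧ p₁₂))
    (hB : ¬ (p₀₁ ∧ p₂₃ ∧ ¬ p₀₃ ∧ ¬ p₁₂ ∧ p₀₂ ∧ p₁₃)) (i : Fin 4)
    (hne : c i ≠ (if i = 0 ∨ i = 1 then
        if ¬ p₀₁ ∧ ¬ p₂₃ ∧ p₀₂ ∧ p₀₃ ∧ p₁₂ ∧ p₁₃ then c 0 - c 2 else 0 else 0) +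
      if ¬ p₀₁ then c 2 else if ¬ p₀₂ ∨ ¬ p₀₃ then c 1 else
        if ¬ p₁₂ ∨ ¬ p₁₃ ∨ ¬ p₂₃ then c 0 else 0) :
    (i ≠ 0 → i ≠ 1 → p₀₁) ∧ (i ≠ 0 → i ≠ 2 → p₀₂) ∧ (i ≠ 0 → i ≠ 3 → p₀₃) ∧
      (i ≠ 1 → i ≠ 2 → p₁₂) ∧ (i ≠ 1 → i ≠ 3 → p₁₃) ∧ (i ≠ 2 → i ≠ 3 → p₂₃) := by
  by_cases q01 : p₀₁ <;> by_cases q02 : p₀₂ <;> by_cases q03 : p₀₃ <;> by_cases q12 : p₁₂ <;>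
    by_cases q13 : p₁₃ <;> by_cases q23 : p₂₃ <;>
    simp only [q01, q02, q03, q12, q13, q23, not_true, not_false_iff, true_and, and_true,
      and_false, imp_true_iff, imp_false, if_true, if_false, not_not, or_true,
      or_false, ite_self, zero_add] at * <;>
    fin_cases i <;> simp_all

end Curve

/-! ### Decomposition of cocycles -/

section Decomposition

variable {K : Type*} [Field K] {a₁ a₂ a₃ a₄ a₅ a₆ : ℕ}
  {I : Ideal (MvPolynomial (Fin 4) K)}

theorem coeff_add_single_X_pow_mul (i : Fin 4) (k : ℕ) (β : Fin 4 →₀ ℕ)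
    (p : MvPolynomial (Fin 4) K) :
    coeff (β + Finsupp.single i k) (X i ^ k * p) = coeff β p := by
  rw [X_pow_eq_monomial, add_comm, coeff_monomial_mul, one_mul]

theorem coeff_X_pow_mul_of_lt {i : Fin 4} {k : ℕ} {β : Fin 4 →₀ ℕ} (h : β i < k)
    (p : MvPolynomial (Fin 4) K) : coeff β (X i ^ k * p) = 0 := by
  rw [X_pow_eq_monomial, coeff_monomial_mul', if_neg]
  intro hle
  have := hle i
  simp only [Finsupp.single_eq_same] at this
  omega

/-- The cocycle condition in a multidegree in `ℕ⁴`. -/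
theorem satisfiesWeights_of_coeff_ne {w : Fin 4 → Fin 4 → ℕ} {k : ℕ}
    {f : Fin 4 → MvPolynomial (Fin 4) K} {i j : Fin 4}
    (h : ∀ β, coeff β (X i ^ k * f j - X j ^ k * f i) ≠ 0 →
      SatisfiesWeights w (Finsupp.single i 1 + Finsupp.single j 1) β) {α : Fin 4 →₀ ℕ}
    (hne : coeff (α + Finsupp.single i k) (f i) ≠ coeff (α + Finsupp.single j k) (f j)) :
    SatisfiesWeights w (Finsupp.single i 1 + Finsupp.single j 1) α := by
  have h1 := h (α + Finsupp.single i k + Finsupp.single j k) (by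
    rw [coeff_sub, coeff_add_single_X_pow_mul, add_right_comm, coeff_add_single_X_pow_mul,
      sub_ne_zero]
    exact hne.symm)
  intro l m hlm hl hm
  have h2 := h1 l m hlm hl hm
  simp only [Finsupp.add_apply, Finsupp.single_apply] at hl hm h2
  split_ifs at hl hm h2
  omega

/-- The cocycle condition in a multidegree with negative `i`-th entry: such a component of a cocycle
vanishes in the localization at `x_i`. -/
theorem satisfiesWeights_of_lt (hI : HasWeights I (edgeWeight a₁ a₂ a₃ a₄ a₅ a₆)) {k : ℕ}
    {z : CechC₁ I} {f : Fin 4 → MvPolynomial (Fin 4) K} (hf : IsRepresentedBy I z k f)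
    (hz : z ∈ LinearMap.ker (cechD₁ I)) {i : Fin 4} {β : Fin 4 →₀ ℕ} (hlt : β i < k)
    (hβ : coeff β (f i) ≠ 0) :
    SatisfiesWeights (edgeWeight a₁ a₂ a₃ a₄ a₅ a₆) (Finsupp.single i 1) β := by
  rw [hf.mem_ker_iff hI] at hz
  have step : ∀ j, j ≠ i → SatisfiesWeights (edgeWeight a₁ a₂ a₃ a₄ a₅ a₆)
      (Finsupp.single i 1 + Finsupp.single j 1) (β + Finsupp.single j k) := by
    intro j hj
    have hlt' : (β + Finsupp.single j k) i < k := by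
      simpa [Finsupp.single_apply, hj] using hlt
    rcases lt_or_gt_of_ne hj with h | h
    · have := hz j i h (β + Finsupp.single j k) (by
        rw [coeff_sub, coeff_add_single_X_pow_mul, coeff_X_pow_mul_of_lt hlt', sub_zero]
        exact hβ)
      rwa [add_comm] at this
    · exact hz i j h (β + Finsupp.single j k) (by
        rw [coeff_sub, coeff_add_single_X_pow_mul, coeff_X_pow_mul_of_lt hlt', zero_sub]
        exact neg_ne_zero.2 hβ)
  intro l m hlm hl hm
  obtain ⟨j, hji, hjl, hjm⟩ : ∃ j : Fin 4, j ≠ i ∧ j ≠ l ∧ j ≠ m := by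
    clear hl hm hlm step hlt hβ
    revert i l m
    decide
  have := step j hji l m hlm (by simp [hl, hjl]) (by simp [hm, hjm])
  simpa [hjl, hjm, Finsupp.single_apply] using this

/-- Every cocycle is cohomologous to a cochain `(g, g, 0, 0)` with `g` supported on the exponents
with disconnected degree complex. The monomials of `g` come from those of the given cocycle. -/
theorem exists_pairCochain_add_cechD₀ (hI : HasWeights I (edgeWeight a₁ a₂ a₃ a₄ a₅ a₆))
    (hstar : max (a₂ + a₅) (a₃ + a₄) ≤ a₁ + a₆) {z : CechC₁ I} {k : ℕ}
    {f : Fin 4 → MvPolynomial (Fin 4) K} (hf : IsRepresentedBy I z k f)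
    (hz : z ∈ LinearMap.ker (cechD₁ I)) :
    ∃ g h : MvPolynomial (Fin 4) K,
      (∀ β, coeff β g ≠ 0 → β ∈ disconnectedExponents a₁ a₂ a₃ a₄ a₅ a₆ ∧
        ∃ i, coeff (β + Finsupp.single i k) (f i) ≠ 0) ∧
      z = pairCochain I g + cechD₀ I (Ideal.Quotient.mk I h) := by
  have hcross := (hf.mem_ker_iff hI).1 hz
  let c : (Fin 4 →₀ ℕ) → Fin 4 → K := fun β i => coeff (β + Finsupp.single i k) (f i)
  let T : Finset (Fin 4 →₀ ℕ) :=
    Finset.univ.biUnion fun i => (f i).support.image (· - Finsupp.single i k)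
  have hT : ∀ β, β ∉ T → ∀ i, c β i = 0 := by
    intro β hn i
    by_contra hβ
    refine hn <| Finset.mem_biUnion.2 ⟨i, Finset.mem_univ _, Finset.mem_image.2
      ⟨β + Finsupp.single i k, mem_support_iff.2 hβ, by simp⟩⟩
  -- `c β i` is the coefficient of `x^β` in the fraction `f i / x_i ^ k`.
  obtain ⟨g, hg⟩ := exists_coeff_eq (K := K) (fun β =>
    if ¬ a₁ ≤ β 0 + β 1 ∧ ¬ a₆ ≤ β 2 + β 3 ∧ a₂ ≤ β 0 + β 2 ∧ a₃ ≤ β 0 + β 3 ∧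
      a₄ ≤ β 1 + β 2 ∧ a₅ ≤ β 1 + β 3 then c β 0 - c β 2 else 0) T (by
    intro β hβ
    by_contra hn
    exact hβ (by simp only [hT β hn, sub_zero, ite_self]))
  obtain ⟨h, hh⟩ := exists_coeff_eq (K := K) (fun β =>
    if ¬ a₁ ≤ β 0 + β 1 then c β 2 else
      if ¬ a₂ ≤ β 0 + β 2 ∨ ¬ a₃ ≤ β 0 + β 3 then c β 1 else
        if ¬ a₄ ≤ β 1 + β 2 ∨ ¬ a₅ ≤ β 1 + β 3 ∨ ¬ a₆ ≤ β 2 + β 3 then c β 0 else 0) T (by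
    intro β hβ
    by_contra hn
    exact hβ (by simp only [hT β hn, ite_self]))
  refine ⟨g, h, fun β hβ => ?_, ?_⟩
  · rw [hg] at hβ
    split_ifs at hβ with hS
    · refine ⟨⟨not_le.1 hS.1, not_le.1 hS.2.1, hS.2.2⟩, ?_⟩
      by_contra hnone
      simp only [not_exists, not_not] at hnone
      exact hβ (by simp only [c, hnone, sub_zero])
    · exact absurd rfl hβ
  · funext i
    rw [Pi.add_apply, pairCochain_apply, cechD₀_mk_apply, ← map_add, ← map_add, ← sub_eq_zero,
      ← X_pow_smul_eq_zero_iff I k, smul_sub, hf i, smul_eq_algebraMap_mul I, ← map_mul,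
      ← map_mul, ← map_sub, ← map_sub, algebraMap_loc₁_eq_zero_iff hI]
    intro β hβ
    rw [coeff_sub] at hβ
    by_cases hlt : β i < k
    · rw [coeff_X_pow_mul_of_lt hlt, sub_zero] at hβ
      exact satisfiesWeights_of_lt hI hf hz hlt hβ
    obtain ⟨α, rfl⟩ : ∃ α, β = α + Finsupp.single i k := by
      refine ⟨β - Finsupp.single i k, (tsub_add_cancel_of_le ?_).symm⟩
      rw [Finsupp.single_le_iff]
      exact not_lt.1 hlt
    rw [coeff_add_single_X_pow_mul, sub_ne_zero, coeff_add, hh,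
      apply_ite (coeff α), coeff_zero, hg] at hβ
    -- What is left is the gluing problem in multidegree `α`; the inequality `hstar` excludes the two
    -- other disconnected degree complexes.
    have hα : SatisfiesWeights (edgeWeight a₁ a₂ a₃ a₄ a₅ a₆) (Finsupp.single i 1) α := by
      have edge : ∀ i j, i < j → c α i ≠ c α j → SatisfiesWeights
          (edgeWeight a₁ a₂ a₃ a₄ a₅ a₆) (Finsupp.single i 1 + Finsupp.single j 1) α :=
        fun i j hij hne => satisfiesWeights_of_coeff_ne (hcross i j hij) hne
      simp only [satisfiesWeights_pair_iff] at edge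
      rw [satisfiesWeights_single_iff]
      refine glue_coefficients (c α)
        (fun hne => (edge 0 1 (by decide) hne).2.2.2.2.2 (by decide) (by decide) (by decide)
          (by decide))
        (fun hne => (edge 0 2 (by decide) hne).2.2.2.2.1 (by decide) (by decide) (by decide)
          (by decide))
        (fun hne => (edge 0 3 (by decide) hne).2.2.2.1 (by decide) (by decide) (by decide)
          (by decide))
        (fun hne => (edge 1 2 (by decide) hne).2.2.1 (by decide) (by decide) (by decide)
          (by decide))
        (fun hne => (edge 1 3 (by decide) hne).2.1 (by decide) (by decide) (by decide)
          (by decide))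
        (fun hne => (edge 2 3 (by decide) hne).1 (by decide) (by decide) (by decide)
          (by decide)) (by omega) (by omega) i hβ
    intro l m hlm hl hm
    have := hα l m hlm hl hm
    simp only [Finsupp.add_apply]
    omega

/-- The class of `(g, g, 0, 0)` is zero as soon as no monomial of `g` has disconnected degree
complex. -/
theorem pairCochain_mem_range (hI : HasWeights I (edgeWeight a₁ a₂ a₃ a₄ a₅ a₆))
    (hstar : max (a₂ + a₅) (a₃ + a₄) ≤ a₁ + a₆) {g : MvPolynomial (Fin 4) K}
    (hg : pairCochain I g ∈ LinearMap.ker (cechD₁ I))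
    (hS : ∀ β, coeff β g ≠ 0 → β ∉ disconnectedExponents a₁ a₂ a₃ a₄ a₅ a₆) :
    pairCochain I g ∈ LinearMap.range (cechD₀ I) := by
  obtain ⟨g', h, hg', heq⟩ :=
    exists_pairCochain_add_cechD₀ hI hstar (pairCochain_isRepresentedBy g) hg
  have h0 : g' = 0 := by
    ext β
    by_contra hne
    obtain ⟨hβ, i, hi⟩ := hg' β hne
    rw [Finsupp.single_zero, add_zero] at hi
    split_ifs at hi
    · exact hS β hi hβ
    · exact hi (coeff_zero β)
  rw [h0, map_zero, zero_add] at heq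
  exact ⟨_, heq.symm⟩

end Decomposition

/-! ### Regular sequences and dimension -/

section CohenMacaulay

variable {K : Type*} [Field K] {I : Ideal (MvPolynomial (Fin 4) K)}

theorem X_mem_idealOfVars (i : Fin 4) : (X i : MvPolynomial (Fin 4) K) ∈ idealOfVars (Fin 4) K :=
  Ideal.subset_span ⟨i, rfl⟩

/-- If no nonzero element of `R/J` is killed by all variables, then the homogeneous maximal ideal
contains an `R/J`-regular element. -/
theorem exists_regular_of_saturated (J : Ideal (MvPolynomial (Fin 4) K))
    (hsat : ∀ h, (∀ i, X i * h ∈ J) → h ∈ J) :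
    ∃ f ∈ idealOfVars (Fin 4) K, ∀ g, f * g ∈ J → g ∈ J := by
  by_contra! hno
  have hdis : Disjoint (((idealOfVars (Fin 4) K).map (Ideal.Quotient.mk J) : Ideal _) :
      Set (MvPolynomial (Fin 4) K ⧸ J)) (nonZeroDivisors (MvPolynomial (Fin 4) K ⧸ J)) := by
    rw [Set.disjoint_left]
    intro x hx hreg
    obtain ⟨f, hf, rfl⟩ :=
      (Ideal.mem_map_iff_of_surjective _ Ideal.Quotient.mk_surjective).1 hx
    obtain ⟨g, hg, hgJ⟩ := hno f hf
    refine hgJ (Ideal.Quotient.eq_zero_iff_mem.1 ?_)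
    refine (mem_nonZeroDivisors_iff.1 hreg).1 _ ?_
    rw [← map_mul]
    exact Ideal.Quotient.eq_zero_iff_mem.2 hg
  obtain ⟨x, hx, hx0⟩ := SetLike.exists_of_lt
    (Ideal.bot_lt_annihilator_of_disjoint_nonZeroDivisors hdis)
  obtain ⟨h, rfl⟩ := Ideal.Quotient.mk_surjective x
  refine hx0 ((Submodule.mem_bot _).2 (Ideal.Quotient.eq_zero_iff_mem.2 (hsat h fun i => ?_)))
  have := Submodule.mem_annihilator.1 hx (Ideal.Quotient.mk J (X i))
    (Ideal.mem_map_of_mem _ (X_mem_idealOfVars i))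
  rw [smul_eq_mul, ← map_mul, mul_comm] at this
  exact Ideal.Quotient.eq_zero_iff_mem.1 this

theorem isRegular_pair (hI : I ≤ idealOfVars (Fin 4) K) {f₁ f₂ : MvPolynomial (Fin 4) K}
    (hf₁ : f₁ ∈ idealOfVars (Fin 4) K) (hf₂ : f₂ ∈ idealOfVars (Fin 4) K)
    (h₁ : ∀ g, f₁ * g ∈ I → g ∈ I)
    (h₂ : ∀ g, f₂ * g ∈ I ⊔ Ideal.span {f₁} → g ∈ I ⊔ Ideal.span {f₁}) :
    RingTheory.Sequence.IsRegular (MvPolynomial (Fin 4) K ⧸ I) [f₁, f₂] := by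
  have hzero : ∀ g : MvPolynomial (Fin 4) K,
      (Submodule.Quotient.mk (Ideal.Quotient.mk I g) :
        QuotSMulTop f₁ (MvPolynomial (Fin 4) K ⧸ I)) = 0 ↔ g ∈ I ⊔ Ideal.span {f₁} := by
    intro g
    rw [Submodule.Quotient.mk_eq_zero, Submodule.mem_smul_pointwise_iff_exists]
    constructor
    · rintro ⟨b, -, hb⟩
      obtain ⟨q, rfl⟩ := Ideal.Quotient.mk_surjective b
      have hb' : Ideal.Quotient.mk I (f₁ * q) = Ideal.Quotient.mk I g := by
        rw [← hb, map_mul]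
        rfl
      rw [Ideal.Quotient.eq] at hb'
      rw [← sub_sub_cancel (f₁ * q) g]
      exact Ideal.sub_mem _ (Ideal.mem_sup_right
        (Ideal.mul_mem_right _ _ (Ideal.mem_span_singleton_self f₁))) (Ideal.mem_sup_left hb')
    · intro hg
      obtain ⟨a, ha, b, hb, rfl⟩ := Submodule.mem_sup.1 hg
      obtain ⟨q, rfl⟩ := Ideal.mem_span_singleton'.1 hb
      refine ⟨Ideal.Quotient.mk I q, trivial, ?_⟩
      rw [map_add, Ideal.Quotient.eq_zero_iff_mem.2 ha, zero_add, mul_comm, map_mul]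
      rfl
  have hne : (⊤ : Submodule (MvPolynomial (Fin 4) K) (MvPolynomial (Fin 4) K ⧸ I)) ≠
      Ideal.ofList [f₁, f₂] • ⊤ := by
    intro h
    have hle : Ideal.ofList [f₁, f₂] ≤ idealOfVars (Fin 4) K := by
      rw [Ideal.ofList, Ideal.span_le]
      intro x hx
      have hx' : x ∈ [f₁, f₂] := hx
      simp only [List.mem_cons, List.not_mem_nil, or_false] at hx'
      rcases hx' with rfl | rfl
      exacts [hf₁, hf₂]
    have hmap : ∀ x : MvPolynomial (Fin 4) K ⧸ I,
        x ∈ Ideal.ofList [f₁, f₂] • (⊤ : Submodule (MvPolynomial (Fin 4) K) _) →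
        x ∈ (idealOfVars (Fin 4) K).map (Ideal.Quotient.mk I) := by
      intro x hx
      refine Submodule.smul_induction_on hx (fun r hr n _ => ?_) (fun _ _ => Ideal.add_mem _)
      exact Ideal.mul_mem_right _ _ (Ideal.mem_map_of_mem _ (hle hr))
    have h1 := hmap 1 (h ▸ Submodule.mem_top)
    rw [← map_one (Ideal.Quotient.mk I), Ideal.mem_quotient_iff_mem hI] at h1
    have h2 := (mem_pow_idealOfVars_iff (σ := Fin 4) (R := K) 1 1).1 (by simpa using h1) 0
      (by simp)
    simp at h2
  refine ⟨?_, hne⟩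
  rw [RingTheory.Sequence.isWeaklyRegular_cons_iff,
    RingTheory.Sequence.isWeaklyRegular_singleton_iff]
  constructor
  · rw [isSMulRegular_iff_right_eq_zero_of_smul]
    intro x hx
    obtain ⟨g, rfl⟩ := Ideal.Quotient.mk_surjective x
    exact Ideal.Quotient.eq_zero_iff_mem.2 (h₁ g (Ideal.Quotient.eq_zero_iff_mem.1 hx))
  · rw [isSMulRegular_iff_right_eq_zero_of_smul]
    intro x hx
    obtain ⟨y, rfl⟩ := Submodule.Quotient.mk_surjective _ x
    obtain ⟨g, rfl⟩ := Ideal.Quotient.mk_surjective y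
    exact (hzero g).2 (h₂ g ((hzero _).1 hx))

theorem exists_complementary_pair {i j : Fin 4} (hij : i ≠ j) :
    ∃ k l : Fin 4, k ≠ i ∧ k ≠ j ∧ l ≠ i ∧ l ≠ j ∧ l ≠ k ∧
      ∀ m, m = i ∨ m = j ∨ m = k ∨ m = l := by
  revert i j
  decide

theorem ringKrullDim_quotient_lineIdeal_le {i j : Fin 4} (hij : i ≠ j) :
    ringKrullDim (MvPolynomial (Fin 4) K ⧸ lineIdeal K i j) ≤ 2 := by
  obtain ⟨k, l, -, -, -, -, -, hall⟩ := exists_complementary_pair hij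
  let φ : MvPolynomial (Fin 2) K →ₐ[K] MvPolynomial (Fin 4) K ⧸ lineIdeal K i j :=
    aeval ![Ideal.Quotient.mk _ (X k), Ideal.Quotient.mk _ (X l)]
  have hφ : Function.Surjective φ := by
    intro x
    obtain ⟨p, rfl⟩ := Ideal.Quotient.mk_surjective x
    change Ideal.Quotient.mk _ p ∈ φ.range
    induction p using MvPolynomial.induction_on with
    | C a => exact φ.range.algebraMap_mem a
    | add p q hp hq => rw [map_add]; exact add_mem hp hq
    | mul_X p m hp =>
      rw [map_mul]
      refine mul_mem hp ?_
      have hmem : m = i ∨ m = j → (Ideal.Quotient.mk (lineIdeal K i j)) (X m) ∈ φ.range := by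
        intro hm
        have h0 : (X m : MvPolynomial (Fin 4) K) ∈ lineIdeal K i j :=
          Ideal.subset_span (by rcases hm with rfl | rfl <;> simp)
        rw [Ideal.Quotient.eq_zero_iff_mem.2 h0]
        exact zero_mem _
      rcases hall m with h | h | rfl | rfl
      · exact hmem (Or.inl h)
      · exact hmem (Or.inr h)
      · exact ⟨X 0, by simp [φ]⟩
      · exact ⟨X 1, by simp [φ]⟩
  refine (ringKrullDim_le_of_surjective φ.toRingHom hφ).trans ?_
  rw [MvPolynomial.ringKrullDim_of_isNoetherianRing, ringKrullDim_eq_zero_of_field]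
  simp

theorem two_le_ringKrullDim_of_le_lineIdeal {i j : Fin 4} (hij : i ≠ j)
    (h : I ≤ lineIdeal K i j) :
    2 ≤ ringKrullDim (MvPolynomial (Fin 4) K ⧸ I) := by
  obtain ⟨k, l, hki, hkj, hli, hlj, hlk, -⟩ := exists_complementary_pair hij
  let ψ : MvPolynomial (Fin 4) K →ₐ[K] MvPolynomial (Fin 2) K :=
    aeval fun m => if m = i ∨ m = j then 0 else if m = k then X 0 else X 1
  have hI : ∀ p ∈ I, ψ p = 0 := by
    intro p hp
    have hle : lineIdeal K i j ≤ RingHom.ker ψ := by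
      rw [lineIdeal, Ideal.span_le]
      rintro x (rfl | rfl) <;> simp [ψ]
    exact hle (h hp)
  have hψ : Function.Surjective ψ := by
    rw [← AlgHom.range_eq_top, eq_top_iff, ← MvPolynomial.adjoin_range_X, Algebra.adjoin_le_iff]
    rintro _ ⟨s, rfl⟩
    fin_cases s
    · exact ⟨X k, by simp [ψ, hki, hkj]⟩
    · exact ⟨X l, by simp [ψ, hli, hlj, hlk]⟩
  have := ringKrullDim_le_of_surjective (Ideal.Quotient.lift I ψ.toRingHom hI)
    (Ideal.Quotient.lift_surjective_of_surjective _ hI hψ)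
  rw [MvPolynomial.ringKrullDim_of_isNoetherianRing, ringKrullDim_eq_zero_of_field] at this
  simpa using this

/-- The dimension of `R/I` is bounded by that of `R/P` when every prime containing `I` contains one
of the ideals `P` of a family. -/
theorem ringKrullDim_quotient_le_of_forall_prime {R : Type*} [CommRing R] {I : Ideal R}
    {d : WithBot ℕ∞} (h : ∀ p : Ideal R, p.IsPrime → I ≤ p → ∃ J ≤ p, ringKrullDim (R ⧸ J) ≤ d) :
    ringKrullDim (R ⧸ I) ≤ d := by
  rw [ringKrullDim_quotient]
  refine iSup_le fun c => ?_
  obtain ⟨J, hJ, hd⟩ := h c.head.1.asIdeal c.head.1.isPrime c.head.2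
  refine le_trans ?_ hd
  rw [ringKrullDim_quotient]
  exact Order.LTSeries.length_le_krullDim (α := PrimeSpectrum.zeroLocus (J : Set R))
    ⟨c.length, fun s => ⟨(c s).1, hJ.trans (c.head_le s)⟩, fun s => c.step s⟩

theorem ringKrullDim_quotient_curveIdeal (K : Type*) [Field K] {a₁ a₂ a₃ a₄ a₅ a₆ : ℕ}
    (hne : ¬ (a₁ = 0 ∧ a₂ = 0 ∧ a₃ = 0 ∧ a₄ = 0 ∧ a₅ = 0 ∧ a₆ = 0)) :
    ringKrullDim (MvPolynomial (Fin 4) K ⧸ curveIdeal K a₁ a₂ a₃ a₄ a₅ a₆) = 2 := by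
  refine le_antisymm (ringKrullDim_quotient_le_of_forall_prime fun p hp hle => ?_) ?_
  · have hpow : ∀ i j a, i ≠ j → lineIdeal K i j ^ a ≤ p →
        ∃ J ≤ p, ringKrullDim (MvPolynomial (Fin 4) K ⧸ J) ≤ 2 := fun i j a hij h =>
      ⟨_, hp.le_of_pow_le h, ringKrullDim_quotient_lineIdeal_le hij⟩
    simp only [curveIdeal, hp.inf_le] at hle
    rcases hle with ((((h | h) | h) | h) | h) | h <;>
      exact hpow _ _ _ (by decide) h
  · have hpow : ∀ i j a, i ≠ j → a ≠ 0 → curveIdeal K a₁ a₂ a₃ a₄ a₅ a₆ ≤ lineIdeal K i j ^ a →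
        2 ≤ ringKrullDim (MvPolynomial (Fin 4) K ⧸ curveIdeal K a₁ a₂ a₃ a₄ a₅ a₆) :=
      fun i j a hij ha h => two_le_ringKrullDim_of_le_lineIdeal hij (h.trans (Ideal.pow_le_self ha))
    by_cases h1 : a₁ = 0
    · by_cases h2 : a₂ = 0
      · by_cases h3 : a₃ = 0
        · by_cases h4 : a₄ = 0
          · by_cases h5 : a₅ = 0
            · by_cases h6 : a₆ = 0
              · exact absurd ⟨h1, h2, h3, h4, h5, h6⟩ hne
              · exact hpow _ _ _ (by decide) h6 fun x hx => hx.2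
            · exact hpow _ _ _ (by decide) h5 fun x hx => hx.1.2
          · exact hpow _ _ _ (by decide) h4 fun x hx => hx.1.1.2
        · exact hpow _ _ _ (by decide) h3 fun x hx => hx.1.1.1.2
      · exact hpow _ _ _ (by decide) h2 fun x hx => hx.1.1.1.1.2
    · exact hpow _ _ _ (by decide) h1 fun x hx => hx.1.1.1.1.1

section Saturated

variable {w : Fin 4 → Fin 4 → ℕ}

/-- A polynomial lies in `I` if it vanishes in all localizations `(R/I)_{x_i}`. -/
theorem mem_of_forall_algebraMap_loc₁_eq_zero (hI : HasWeights I w) {h : MvPolynomial (Fin 4) K}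
    (hh : ∀ i, algebraMap (MvPolynomial (Fin 4) K ⧸ I) (Loc₁ I i) (Ideal.Quotient.mk I h) = 0) :
    h ∈ I := by
  refine (hI h).2 fun β hβ l m hlm _ _ => ?_
  obtain ⟨j, hjl, hjm⟩ : ∃ j : Fin 4, j ≠ l ∧ j ≠ m := by
    clear hlm
    revert l m
    decide
  exact (algebraMap_loc₁_eq_zero_iff hI j h).1 (hh j) β hβ l m hlm (by simp [hjl]) (by simp [hjm])

theorem algebraMap_loc₁_eq_zero_of_X_mul_mem {i : Fin 4} {h : MvPolynomial (Fin 4) K}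
    (hh : X i * h ∈ I) :
    algebraMap (MvPolynomial (Fin 4) K ⧸ I) (Loc₁ I i) (Ideal.Quotient.mk I h) = 0 := by
  rw [← X_pow_smul_eq_zero_iff I 1, pow_one, smul_eq_algebraMap_mul I, ← map_mul, ← map_mul,
    Ideal.Quotient.eq_zero_iff_mem.2 hh, map_zero]

theorem mem_of_forall_X_mul_mem (hI : HasWeights I w) {h : MvPolynomial (Fin 4) K}
    (hh : ∀ i, X i * h ∈ I) : h ∈ I :=
  mem_of_forall_algebraMap_loc₁_eq_zero hI fun i => algebraMap_loc₁_eq_zero_of_X_mul_mem (hh i)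

/-- Vanishing of the first local cohomology makes `I + (f)` saturated for a regular element `f`:
if `x_i h ≡ f g_i` modulo `I` for all `i`, then `(g_i / x_i)` is a cocycle, hence comes from some
`g` in `R`, and then `h ≡ f g` modulo `I`. -/
theorem mem_sup_span_of_forall_X_mul_mem (hI : HasWeights I w)
    (hH : LinearMap.ker (cechD₁ I) ≤ LinearMap.range (cechD₀ I)) {f : MvPolynomial (Fin 4) K}
    (hf : ∀ g, f * g ∈ I → g ∈ I) {h : MvPolynomial (Fin 4) K}
    (hh : ∀ i, X i * h ∈ I ⊔ Ideal.span {f}) : h ∈ I ⊔ Ideal.span {f} := by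
  have hg : ∀ i, ∃ g, X i * h - f * g ∈ I := by
    intro i
    obtain ⟨a, ha, b, hb, hab⟩ := Submodule.mem_sup.1 (hh i)
    obtain ⟨q, rfl⟩ := Ideal.mem_span_singleton'.1 hb
    exact ⟨q, by rwa [← hab, mul_comm f, add_sub_cancel_right]⟩
  choose g hg using hg
  have hcross : ∀ i j, X i * g j - X j * g i ∈ I := by
    intro i j
    refine hf _ ?_
    have := I.sub_mem (I.mul_mem_left (X j) (hg i)) (I.mul_mem_left (X i) (hg j))
    convert this using 1
    ring
  have hunit : ∀ i, IsUnit (algebraMap (MvPolynomial (Fin 4) K ⧸ I) (Loc₁ I i) (coord I i)) :=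
    fun i => IsLocalization.Away.algebraMap_isUnit (coord I i)
  let z : CechC₁ I := fun i => ↑(hunit i).unit⁻¹ *
    algebraMap (MvPolynomial (Fin 4) K ⧸ I) (Loc₁ I i) (Ideal.Quotient.mk I (g i))
  have hz : IsRepresentedBy I z 1 g := by
    intro i
    rw [pow_one, smul_eq_algebraMap_mul I]
    exact (hunit i).unit.mul_inv_cancel_left _
  have hker : z ∈ LinearMap.ker (cechD₁ I) := by
    rw [hz.mem_ker_iff hI]
    intro i j _
    rw [← algebraMap_loc₂_eq_zero_iff hI, pow_one, pow_one,
      Ideal.Quotient.eq_zero_iff_mem.2 (hcross i j), map_zero]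
  obtain ⟨q', hq⟩ := hH hker
  obtain ⟨q, rfl⟩ := Ideal.Quotient.mk_surjective q'
  have hmem : h - f * q ∈ I := by
    refine mem_of_forall_algebraMap_loc₁_eq_zero hI fun i => ?_
    rw [← X_pow_smul_eq_zero_iff I 1]
    have h1 : (X i ^ 1 : MvPolynomial (Fin 4) K) • z i =
        (X i ^ 1 : MvPolynomial (Fin 4) K) •
          algebraMap (MvPolynomial (Fin 4) K ⧸ I) (Loc₁ I i) (Ideal.Quotient.mk I q) := by
      rw [← cechD₀_mk_apply, hq]
    rw [hz i, pow_one, smul_eq_algebraMap_mul I, ← map_mul, ← map_mul] at h1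
    have h2 := Ideal.Quotient.eq_zero_iff_mem.2 (hg i)
    rw [pow_one, smul_eq_algebraMap_mul I, ← map_mul, ← map_mul, mul_sub, mul_left_comm,
      map_sub, map_sub, map_mul _ f, map_mul _ (Ideal.Quotient.mk I f), ← h1, ← map_mul, ← map_mul,
      ← map_sub, ← map_sub, h2, map_zero]
  rw [← sub_add_cancel h (f * q)]
  exact Ideal.add_mem _ (Ideal.mem_sup_left hmem) (Ideal.mem_sup_right
    (Ideal.mul_mem_right _ _ (Ideal.mem_span_singleton_self f)))

end Saturated

theorem curveIdeal_le_idealOfVars (K : Type*) [Field K] {a₁ a₂ a₃ a₄ a₅ a₆ : ℕ}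
    (hne : ¬ (a₁ = 0 ∧ a₂ = 0 ∧ a₃ = 0 ∧ a₄ = 0 ∧ a₅ = 0 ∧ a₆ = 0)) :
    curveIdeal K a₁ a₂ a₃ a₄ a₅ a₆ ≤ idealOfVars (Fin 4) K := by
  intro p hp
  rw [← pow_one (idealOfVars (Fin 4) K), mem_pow_idealOfVars_iff]
  intro β hβ
  have h := (curveIdeal_hasWeights K a₁ a₂ a₃ a₄ a₅ a₆ p).1 hp β (mem_support_iff.1 hβ)
  by_contra hlt
  have h0 : β = 0 := (Finsupp.degree_eq_zero_iff β).1 (by omega)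
  subst h0
  refine hne ⟨?_, ?_, ?_, ?_, ?_, ?_⟩
  · simpa [edgeWeight] using h 0 1 (by decide) rfl rfl
  · simpa [edgeWeight] using h 0 2 (by decide) rfl rfl
  · simpa [edgeWeight] using h 0 3 (by decide) rfl rfl
  · simpa [edgeWeight] using h 1 2 (by decide) rfl rfl
  · simpa [edgeWeight] using h 1 3 (by decide) rfl rfl
  · simpa [edgeWeight] using h 2 3 (by decide) rfl rfl

/-- If `H¹_𝔪(R/I) = 0`, then prime avoidance, applied to `R/I` and to `R/(I + (f₁))`, yields a
regular sequence whose length is the dimension. -/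
theorem isArithmeticallyCohenMacaulay_of_ker_le_range {a₁ a₂ a₃ a₄ a₅ a₆ : ℕ}
    (hne : ¬ (a₁ = 0 ∧ a₂ = 0 ∧ a₃ = 0 ∧ a₄ = 0 ∧ a₅ = 0 ∧ a₆ = 0))
    (hH : LinearMap.ker (cechD₁ (curveIdeal K a₁ a₂ a₃ a₄ a₅ a₆)) ≤
      LinearMap.range (cechD₀ (curveIdeal K a₁ a₂ a₃ a₄ a₅ a₆))) :
    IsArithmeticallyCohenMacaulay (curveIdeal K a₁ a₂ a₃ a₄ a₅ a₆) := by
  have hI := curveIdeal_hasWeights K a₁ a₂ a₃ a₄ a₅ a₆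
  obtain ⟨f₁, hf₁, h₁⟩ := exists_regular_of_saturated _ fun h hh => mem_of_forall_X_mul_mem hI hh
  obtain ⟨f₂, hf₂, h₂⟩ := exists_regular_of_saturated _ fun h hh =>
    mem_sup_span_of_forall_X_mul_mem hI hH h₁ hh
  refine ⟨[f₁, f₂], ?_, isRegular_pair (curveIdeal_le_idealOfVars K hne) hf₁ hf₂ h₁ h₂, ?_⟩
  · simp [hf₁, hf₂]
  · rw [ringKrullDim_quotient_curveIdeal K hne]
    rfl

end CohenMacaulay

/-! ### The graded pieces and the powers of the maximal ideal -/

section Main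

variable {K : Type*} [Field K] {a₁ a₂ a₃ a₄ a₅ a₆ : ℕ}
  {I : Ideal (MvPolynomial (Fin 4) K)}

variable (I) in
/-- The class of a cocycle in `H¹_𝔪(R/I)`. -/
def cocycleClass : LinearMap.ker (cechD₁ I) →ₗ[MvPolynomial (Fin 4) K] LocalCohomology₁ I :=
  ((LinearMap.range (cechD₀ I)).submoduleOf (LinearMap.ker (cechD₁ I))).mkQ

theorem cocycleClass_eq_zero_iff (z : LinearMap.ker (cechD₁ I)) :
    cocycleClass I z = 0 ↔ (z : CechC₁ I) ∈ LinearMap.range (cechD₀ I) := by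
  rw [cocycleClass, Submodule.mkQ_apply, Submodule.Quotient.mk_eq_zero]
  exact Iff.rfl

theorem cocycleClass_surjective : Function.Surjective (cocycleClass I) :=
  Submodule.mkQ_surjective _

theorem mem_localCohomology₁Deg_iff {n : ℤ} {x : LocalCohomology₁ I} :
    x ∈ localCohomology₁Deg I n ↔
      ∃ z : LinearMap.ker (cechD₁ I), (z : CechC₁ I) ∈ cechC₁Deg I n ∧ cocycleClass I z = x :=
  Iff.rfl

theorem pairCochain_monomial_mem_ker (hI : HasWeights I (edgeWeight a₁ a₂ a₃ a₄ a₅ a₆))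
    {α : Fin 4 →₀ ℕ} (hα : α ∈ disconnectedExponents a₁ a₂ a₃ a₄ a₅ a₆) :
    pairCochain I (monomial α 1) ∈ LinearMap.ker (cechD₁ I) := by
  refine pairCochain_mem_ker hI fun β hβ => ?_
  rw [coeff_monomial] at hβ
  split_ifs at hβ with h
  · exact h ▸ hα.2.2
  · exact absurd rfl hβ

theorem pairCochain_monomial_mem_deg (α : Fin 4 →₀ ℕ) :
    pairCochain I (monomial α 1) ∈ cechC₁Deg I α.degree := by
  intro i
  refine ⟨0, α.degree, if i = 0 ∨ i = 1 then monomial α 1 else 0, ?_, by simp, ?_⟩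
  · split_ifs
    · exact isHomogeneous_monomial _ rfl
    · exact isHomogeneous_zero _ _ _
  · rw [pow_zero, one_smul, pairCochain_apply]

theorem localCohomology₁Deg_ne_bot_iff (hI : HasWeights I (edgeWeight a₁ a₂ a₃ a₄ a₅ a₆))
    (hstar : max (a₂ + a₅) (a₃ + a₄) ≤ a₁ + a₆) (n : ℤ) :
    localCohomology₁Deg I n ≠ ⊥ ↔
      ∃ α ∈ disconnectedExponents a₁ a₂ a₃ a₄ a₅ a₆, (α.degree : ℤ) = n := by
  rw [Submodule.ne_bot_iff]
  constructor
  · rintro ⟨x, hx, hx0⟩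
    obtain ⟨z, hz, rfl⟩ := mem_localCohomology₁Deg_iff.1 hx
    obtain ⟨k, f, hf, hdeg⟩ := exists_isRepresentedBy_of_mem_deg hz
    obtain ⟨g, h, hg, heq⟩ := exists_pairCochain_add_cechD₀ hI hstar hf z.2
    have hg0 : g ≠ 0 := by
      rintro rfl
      rw [map_zero, zero_add] at heq
      exact hx0 ((cocycleClass_eq_zero_iff z).2 ⟨_, heq.symm⟩)
    obtain ⟨α, hα⟩ := ne_zero_iff.1 hg0
    obtain ⟨hαS, i, hi⟩ := hg α hα
    refine ⟨α, hαS, ?_⟩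
    have := hdeg i _ hi
    rw [map_add, Finsupp.degree_single] at this
    push_cast at this
    omega
  · rintro ⟨α, hα, rfl⟩
    refine ⟨cocycleClass I ⟨_, pairCochain_monomial_mem_ker hI hα⟩,
      mem_localCohomology₁Deg_iff.2 ⟨_, pairCochain_monomial_mem_deg α, rfl⟩, fun h0 => ?_⟩
    exact pairCochain_monomial_notMem_range hI hα ((cocycleClass_eq_zero_iff _).1 h0)

theorem ker_le_range_of_disconnectedExponents_eq_empty
    (hI : HasWeights I (edgeWeight a₁ a₂ a₃ a₄ a₅ a₆))
    (hstar : max (a₂ + a₅) (a₃ + a₄) ≤ a₁ + a₆)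
    (hS : disconnectedExponents a₁ a₂ a₃ a₄ a₅ a₆ = ∅) :
    LinearMap.ker (cechD₁ I) ≤ LinearMap.range (cechD₀ I) := by
  intro z hz
  obtain ⟨k, f, hf⟩ := exists_isRepresentedBy z
  obtain ⟨g, h, hg, rfl⟩ := exists_pairCochain_add_cechD₀ hI hstar hf hz
  have hg0 : g = 0 := by
    ext α
    by_contra hα
    exact Set.notMem_empty α (hS ▸ (hg α hα).1)
  rw [hg0, map_zero, zero_add]
  exact ⟨_, rfl⟩

/-- Products with forms of degree `D` push all monomials of a representative beyond the largest
degree `a₁ + a₆ - 2` of a point with disconnected degree complex. -/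
theorem pow_smul_top_eq_bot (hI : HasWeights I (edgeWeight a₁ a₂ a₃ a₄ a₅ a₆))
    (hstar : max (a₂ + a₅) (a₃ + a₄) ≤ a₁ + a₆) {D : ℕ}
    (hD : (a₁ : ℤ) + a₆ - 1 ≤ maxA a₁ a₂ a₃ a₄ a₅ a₆ + D) :
    idealOfVars (Fin 4) K ^ D • (⊤ : Submodule (MvPolynomial (Fin 4) K) (LocalCohomology₁ I)) =
      ⊥ := by
  rw [eq_bot_iff]
  refine Submodule.smul_le.2 fun p hp x _ => ?_
  obtain ⟨z, rfl⟩ := cocycleClass_surjective x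
  obtain ⟨k, f, hf⟩ := exists_isRepresentedBy (z : CechC₁ I)
  obtain ⟨g, h, hg, heq⟩ := exists_pairCochain_add_cechD₀ hI hstar hf z.2
  have hker : pairCochain I g ∈ LinearMap.ker (cechD₁ I) :=
    pairCochain_mem_ker hI fun β hβ => (hg β hβ).1.2.2
  rw [Submodule.mem_bot, ← map_smul, cocycleClass_eq_zero_iff, Submodule.coe_smul, heq, smul_add]
  refine Submodule.add_mem _ ?_ (Submodule.smul_mem _ _ ⟨_, rfl⟩)
  rw [← map_smul]
  refine pairCochain_mem_range hI hstar ?_ fun β hβ hβS => ?_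
  · rw [map_smul]
    exact Submodule.smul_mem _ _ hker
  · rw [smul_eq_mul] at hβ
    obtain ⟨γ, hγ, δ, hδ, rfl⟩ :=
      Finset.mem_add.1 (support_mul p g (mem_support_iff.2 hβ))
    have h1 := (mem_pow_idealOfVars_iff D p).1 hp γ hγ
    have h2 := maxA_le_degree (hg δ (mem_support_iff.1 hδ)).1
    have h3 := degree_add_two_le hβS
    rw [map_add] at h3
    omega

/-- Multiplication by `x^γ` does not kill the class of `x^α` when both `α` and `α + γ` have
disconnected degree complex. -/
theorem pow_smul_top_ne_bot (hI : HasWeights I (edgeWeight a₁ a₂ a₃ a₄ a₅ a₆))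
    {α γ : Fin 4 →₀ ℕ} (hα : α ∈ disconnectedExponents a₁ a₂ a₃ a₄ a₅ a₆)
    (hγ : γ + α ∈ disconnectedExponents a₁ a₂ a₃ a₄ a₅ a₆) {k : ℕ} (hk : k ≤ γ.degree) :
    idealOfVars (Fin 4) K ^ k • (⊤ : Submodule (MvPolynomial (Fin 4) K) (LocalCohomology₁ I)) ≠
      ⊥ := by
  intro hbot
  have hmem : (monomial γ (1 : K)) • cocycleClass I ⟨_, pairCochain_monomial_mem_ker hI hα⟩ ∈
      idealOfVars (Fin 4) K ^ k •
        (⊤ : Submodule (MvPolynomial (Fin 4) K) (LocalCohomology₁ I)) :=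
    Submodule.smul_mem_smul ((monomial_mem_pow_idealOfVars_iff k γ one_ne_zero).2 hk) trivial
  rw [hbot, Submodule.mem_bot, ← map_smul, cocycleClass_eq_zero_iff, Submodule.coe_smul,
    ← map_smul, smul_eq_mul, monomial_mul, one_mul] at hmem
  exact pairCochain_monomial_notMem_range hI hγ hmem

end Main

end TetrahedralCurve

end

open TetrahedralCurve in
theorem theorem3p4 {K : Type*} [Field K] (a₁ a₂ a₃ a₄ a₅ a₆ : ℕ)
    (hne : ¬ (a₁ = 0 ∧ a₂ = 0 ∧ a₃ = 0 ∧ a₄ = 0 ∧ a₅ = 0 ∧ a₆ = 0))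
    (hstar : max (a₂ + a₅) (a₃ + a₄) ≤ a₁ + a₆)
    (hACM : ¬ IsArithmeticallyCohenMacaulay (curveIdeal K a₁ a₂ a₃ a₄ a₅ a₆)) :
    maxA a₁ a₂ a₃ a₄ a₅ a₆ ≤ (a₁ : ℤ) + a₆ - 2 ∧
    (degreeSupport (localCohomology₁Deg (curveIdeal K a₁ a₂ a₃ a₄ a₅ a₆))).Finite ∧
    (∃ k : ℕ,
      IsLeast {k : ℕ | MvPolynomial.idealOfVars (Fin 4) K ^ k •
        (⊤ : Submodule (MvPolynomial (Fin 4) K)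
          (LocalCohomology₁ (curveIdeal K a₁ a₂ a₃ a₄ a₅ a₆))) = ⊥} k ∧
      (k : ℤ) = diam (localCohomology₁Deg (curveIdeal K a₁ a₂ a₃ a₄ a₅ a₆))) ∧
    diam (localCohomology₁Deg (curveIdeal K a₁ a₂ a₃ a₄ a₅ a₆)) =
      (a₁ : ℤ) + a₆ - maxA a₁ a₂ a₃ a₄ a₅ a₆ - 1 ∧
    HasNoGap (localCohomology₁Deg (curveIdeal K a₁ a₂ a₃ a₄ a₅ a₆)) := by
  have hI := curveIdeal_hasWeights K a₁ a₂ a₃ a₄ a₅ a₆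
  have hS : (disconnectedExponents a₁ a₂ a₃ a₄ a₅ a₆).Nonempty := by
    rw [Set.nonempty_iff_ne_empty]
    exact fun h => hACM (isArithmeticallyCohenMacaulay_of_ker_le_range hne
      (ker_le_range_of_disconnectedExponents_eq_empty hI hstar h))
  obtain ⟨α, hα, hαA⟩ := exists_degree_eq_maxA hS
  have hle : maxA a₁ a₂ a₃ a₄ a₅ a₆ ≤ (a₁ : ℤ) + a₆ - 2 := by
    have := degree_add_two_le hα
    omega
  have hdeg : ∀ n, localCohomology₁Deg (curveIdeal K a₁ a₂ a₃ a₄ a₅ a₆) n ≠ ⊥ ↔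
      n ∈ Set.Icc (maxA a₁ a₂ a₃ a₄ a₅ a₆) ((a₁ : ℤ) + a₆ - 2) := fun n =>
    (localCohomology₁Deg_ne_bot_iff hI hstar n).trans (exists_degree_eq_iff hS n)
  have hsupp : degreeSupport (localCohomology₁Deg (curveIdeal K a₁ a₂ a₃ a₄ a₅ a₆)) =
      Set.Icc (maxA a₁ a₂ a₃ a₄ a₅ a₆) ((a₁ : ℤ) + a₆ - 2) := Set.ext hdeg
  have hdiam : diam (localCohomology₁Deg (curveIdeal K a₁ a₂ a₃ a₄ a₅ a₆)) =
      (a₁ : ℤ) + a₆ - maxA a₁ a₂ a₃ a₄ a₅ a₆ - 1 := by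
    rw [diam, hsupp, if_neg (Set.nonempty_Icc.2 hle).ne_empty, csSup_Icc hle, csInf_Icc hle]
    ring
  refine ⟨hle, hsupp ▸ Set.finite_Icc _ _,
    ⟨((a₁ : ℤ) + a₆ - maxA a₁ a₂ a₃ a₄ a₅ a₆ - 1).toNat, ⟨?_, fun k hk => ?_⟩, ?_⟩, hdiam,
    hsupp ▸ Set.nonempty_Icc.2 hle, fun i j _ hi hj k hik hkj => ?_⟩
  · exact pow_smul_top_eq_bot hI hstar (by omega)
  · by_contra hlt
    -- A point of least degree lies below one of greatest degree, and the difference has degree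
    -- `diam H - 1`.
    obtain ⟨β, hβ, hαβ, hβd⟩ := exists_le_degree_eq hα (d := a₁ + a₆ - 2) (by omega) (by omega)
    obtain ⟨γ, rfl⟩ := exists_add_of_le hαβ
    rw [map_add] at hβd
    exact pow_smul_top_ne_bot hI hα (add_comm α γ ▸ hβ) (by omega) hk
  · rw [hdiam]
    omega
  · rw [hdeg] at hi hj ⊢
    exact ⟨hi.1.trans hik, hkj.trans hj.2⟩
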